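/- Bradley–Terry–Luce model, league format: $d\ge 2$ items have a parameter vector $\theta^*\in\mathbb{R}^d$; every pair $i<j$ is compared $k$ times, all comparisons are independent, and in each of them $i$ beats $j$ with probability $1/(1+e^{-(\theta^*_i-\theta^*_j)})$ (otherwise $j$ beats $i$). Let $W_{ij}$ be the number of times that $i$ beats $j$, and let $$\ell(\theta)=-\sum_{1\le i<j\le d}\Big[W_{ij}\log\frac{1}{1+e^{-(\theta_i-\theta_j)}}+W_{ji}\log\frac{1}{1+e^{-(\theta_j-\theta_i)}}\Big]$$ be the negative log-likelihood. For $A>0$ put $\Theta_A=\{\theta\in\mathbb{R}^d:\ \|\theta\|_\infty\le A,\ \sum_{i=1}^d\theta_i=0\}$ and let $\hat\theta^{(A)}=\operatorname{argmin}_{\theta\in\Theta_A}\ell(\theta)$ (which exists and is unique for $k\ge 1$). For a constant $B>0$, define the worst-case bias of an estimator $\hat\theta$ by $\beta(\hat\theta)=\sup_{\theta^*\in\Theta_B}\|\mathbb{E}_{\theta^*}[\hat\theta]-\theta^*\|_\infty$. **Theorem.** Let $B>0$. (a) (Standard MLE.) There are constants $c>0$, $d_0$ and $k_0$ that depend only on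 $B$ such that, for all $d\ge d_0$ and all $k\ge k_0$, $$\beta(\hat\theta^{(B)})\ \ge\ \frac{c}{\sqrt{dk}}.$$ Moreover, the vector $\theta^*=\big[B,-\tfrac{B}{d-1},\dots,-\tfrac{B}{d-1}\big]$ lies in $\Theta_B$, and $\|\mathbb{E}_{\theta^*}[\hat\theta^{(B)}]-\theta^*\|_\infty\ge c/\sqrt{dk}$ at this $\theta^*$. (b) (Stretched MLE.) Let $A$ be any finite constant with $A>B$. There are constants $c>0$, $d_0$ and $k_0$ that depend only on $A$ and $B$ such that, for all $d\ge d_0$ and all $k\ge k_0$, $$\beta(\hat\theta^{(A)})\ \le\ c\,\frac{\log d+\log k}{dk}.$$ -/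

import Mathlib

open scoped BigOperators ENNReal
open MeasureTheory ProbabilityTheory

namespace BTL

/-- The centered box `Θ_B`: vectors with `ℓ^∞` norm at most `B` whose entries sum to `0`
(the norm on `Fin d → ℝ` is the sup norm). -/
def box (d : ℕ) (B : ℝ) : Set (Fin d → ℝ) :=
  {θ | ‖θ‖ ≤ B ∧ ∑ i, θ i = 0}

/-- Unordered pairs of distinct items, written as `(i, j)` with `i < j`. -/
abbrev Pair (d : ℕ) : Type := {p : Fin d × Fin d // p.1 < p.2}

/-- The outcomes of all comparisons in the league format: every pair is compared `k` times, and
`ω (⟨(i, j), _⟩, r) = true` means that item `i` beats item `j` in their `r`-th comparison. -/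
abbrev Outcome (d k : ℕ) : Type := Pair d × Fin k → Bool

/-- The law of the outcomes under the Bradley-Terry-Luce model with parameter `θ`: independent
comparisons, in which `i` beats `j` with probability `1 / (1 + exp (-(θ i - θ j)))`. -/
noncomputable def law {d : ℕ} (k : ℕ) (θ : Fin d → ℝ) : Measure (Outcome d k) :=
  Measure.pi fun c : Pair d × Fin k =>
    bernoulliMeasure true false (unitInterval.sigmoid (θ c.1.1.1 - θ c.1.1.2))

/-- The number of times that item `i` beats item `j`. -/
def wins {d k : ℕ} (ω : Outcome d k) (i j : Fin d) : ℕ :=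
  if h : i < j then (Finset.univ.filter fun r : Fin k => ω (⟨(i, j), h⟩, r) = true).card
  else if h : j < i then (Finset.univ.filter fun r : Fin k => ω (⟨(j, i), h⟩, r) = false).card
  else 0

/-- The negative log-likelihood of the parameter `θ` given the win counts `W`. -/
noncomputable def negLogLik {d : ℕ} (W : Fin d → Fin d → ℕ) (θ : Fin d → ℝ) : ℝ :=
  - ∑ p : Pair d,
    ((W p.1.1 p.1.2 : ℝ) * Real.log (1 / (1 + Real.exp (-(θ p.1.1 - θ p.1.2)))) +
      (W p.1.2 p.1.1 : ℝ) * Real.log (1 / (1 + Real.exp (-(θ p.1.2 - θ p.1.1)))))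

/-- `θ` minimizes the negative log-likelihood over the centered box `Θ_A`. -/
def IsBoxMLE {d k : ℕ} (A : ℝ) (ω : Outcome d k) (θ : Fin d → ℝ) : Prop :=
  θ ∈ box d A ∧ IsMinOn (negLogLik (wins ω)) (box d A) θ

/-- The maximum likelihood estimator constrained to `Θ_A`, the minimizer of the negative
log-likelihood over `Θ_A`; it exists and is unique, see `existsUnique_isBoxMLE`. -/
noncomputable def mle {d k : ℕ} (A : ℝ) (ω : Outcome d k) : Fin d → ℝ :=
  Classical.epsilon (IsBoxMLE A ω)

/-- `‖E[θ̂] - θ*‖_∞`, the expectation being under the model with true parameter `θ*`. -/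
noncomputable def biasAt {d k : ℕ} (est : Outcome d k → Fin d → ℝ) (θ : Fin d → ℝ) : ℝ≥0∞ :=
  ‖(∫ ω, est ω ∂(law k θ)) - θ‖ₑ

/-- The worst-case bias of an estimator over the true parameters in `Θ_B`. -/
noncomputable def bias {d k : ℕ} (B : ℝ) (est : Outcome d k → Fin d → ℝ) : ℝ≥0∞ :=
  ⨆ θ ∈ box d B, biasAt est θ

/-- The vector `[B, -B/(d-1), …, -B/(d-1)]`. -/
noncomputable def spike (d : ℕ) (B : ℝ) : Fin d → ℝ :=
  fun i => if (i : ℕ) = 0 then B else -(B / ((d : ℝ) - 1))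

instance {d k : ℕ} (θ : Fin d → ℝ) : IsProbabilityMeasure (law k θ) := by
  unfold law; infer_instance

theorem wins_add_wins {d k : ℕ} (ω : Outcome d k) {i j : Fin d} (h : i < j) :
    wins ω i j + wins ω j i = k := by
  have h' : ¬ j < i := not_lt.mpr h.le
  simp only [wins, h, h', dif_pos, dif_neg, not_false_eq_true]
  have := Finset.card_filter_add_card_filter_not (s := (Finset.univ : Finset (Fin k)))
    (fun r : Fin k => ω (⟨(i, j), h⟩, r) = true)
  simpa using this

theorem isCompact_box (d : ℕ) (A : ℝ) : IsCompact (box d A) := by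
  have : box d A = Metric.closedBall 0 A ∩ {θ : Fin d → ℝ | ∑ i, θ i = 0} := by
    ext θ; simp [box]
  rw [this]
  exact (isCompact_closedBall _ _).inter_right
    (isClosed_eq (by fun_prop) continuous_const)

theorem continuous_negLogLik {d : ℕ} (W : Fin d → Fin d → ℕ) : Continuous (negLogLik W) := by
  unfold negLogLik
  have h : ∀ i j : Fin d, Continuous fun θ : Fin d → ℝ =>
      Real.log (1 / (1 + Real.exp (-(θ i - θ j)))) := by
    intro i j
    have hp : ∀ θ : Fin d → ℝ, 1 + Real.exp (-(θ i - θ j)) ≠ 0 := fun θ => by positivity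
    refine Continuous.log (Continuous.div continuous_const (by fun_prop) hp) fun θ => ?_
    have := hp θ
    positivity
  exact (continuous_finsetSum _ fun p _ =>
    (continuous_const.mul (h _ _)).add (continuous_const.mul (h _ _))).neg

theorem log_midpoint (x y : ℝ) :
    Real.log (1 / (1 + Real.exp (-x))) + Real.log (1 / (1 + Real.exp (-y))) ≤
        2 * Real.log (1 / (1 + Real.exp (-((x + y) / 2)))) ∧
      (x ≠ y → Real.log (1 / (1 + Real.exp (-x))) + Real.log (1 / (1 + Real.exp (-y))) <
        2 * Real.log (1 / (1 + Real.exp (-((x + y) / 2))))) := by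
  have ex : Real.exp (-x) = Real.exp (-x / 2) ^ 2 := by
    rw [← Real.exp_nat_mul]; congr 1; push_cast; ring
  have ey : Real.exp (-y) = Real.exp (-y / 2) ^ 2 := by
    rw [← Real.exp_nat_mul]; congr 1; push_cast; ring
  have em : Real.exp (-((x + y) / 2)) = Real.exp (-x / 2) * Real.exp (-y / 2) := by
    rw [← Real.exp_add]; congr 1; ring
  have ha := Real.exp_pos (-x / 2)
  have hb := Real.exp_pos (-y / 2)
  have hab : x ≠ y → Real.exp (-x / 2) - Real.exp (-y / 2) ≠ 0 := by
    intro hne h0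
    have := Real.exp_injective (sub_eq_zero.mp h0)
    apply hne; linarith
  rw [ex, ey, em]
  generalize Real.exp (-x / 2) = a at *
  generalize Real.exp (-y / 2) = b at *
  have h1 : (0 : ℝ) < 1 + a ^ 2 := by positivity
  have h2 : (0 : ℝ) < 1 + b ^ 2 := by positivity
  have h3 : (0 : ℝ) < 1 + a * b := by positivity
  simp only [one_div, Real.log_inv]
  have e1 : Real.log (1 + a ^ 2) + Real.log (1 + b ^ 2) =
      Real.log ((1 + a ^ 2) * (1 + b ^ 2)) := (Real.log_mul h1.ne' h2.ne').symm
  have e2 : 2 * Real.log (1 + a * b) = Real.log ((1 + a * b) ^ 2) := by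
    rw [Real.log_pow]; norm_num
  constructor
  · have := Real.log_le_log (by positivity : (0 : ℝ) < (1 + a * b) ^ 2)
      (show (1 + a * b) ^ 2 ≤ (1 + a ^ 2) * (1 + b ^ 2) by nlinarith [sq_nonneg (a - b)])
    linarith
  · intro hne
    have hpos : 0 < (a - b) ^ 2 := by have := hab hne; positivity
    have := Real.log_lt_log (by positivity : (0 : ℝ) < (1 + a * b) ^ 2)
      (show (1 + a * b) ^ 2 < (1 + a ^ 2) * (1 + b ^ 2) by nlinarith)
    linarith

/-- For `A ≥ 0` and `k ≥ 1` the box-constrained maximum likelihood estimator exists and is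
unique, for every outcome of the comparisons. -/
theorem existsUnique_isBoxMLE {d k : ℕ} {A : ℝ} (hA : 0 ≤ A) (hk : 1 ≤ k) (ω : Outcome d k) :
    ∃! θ, IsBoxMLE A ω θ := by
  obtain ⟨θ, hθ, hmin⟩ := (isCompact_box d A).exists_isMinOn ⟨0, by simpa [box] using hA⟩
    (continuous_negLogLik (wins ω)).continuousOn
  refine ⟨θ, ⟨hθ, hmin⟩, ?_⟩
  rintro η ⟨hη, hηmin⟩
  by_contra hne
  set m : Fin d → ℝ := fun i => (η i + θ i) / 2 with hm
  have hmid : m ∈ box d A := by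
    refine ⟨(pi_norm_le_iff_of_nonneg hA).mpr fun i => ?_, ?_⟩
    · have h1 := abs_le.mp ((norm_le_pi_norm η i).trans hη.1)
      have h2 := abs_le.mp ((norm_le_pi_norm θ i).trans hθ.1)
      rw [Real.norm_eq_abs, abs_le]
      constructor <;> simp only [hm] <;> linarith
    · rw [← Finset.sum_div, Finset.sum_add_distrib, hη.2, hθ.2]; norm_num
  have hdiff : ∃ i j : Fin d, i < j ∧ η i - η j ≠ θ i - θ j := by
    by_contra! hall
    have hall' : ∀ i j : Fin d, η i - θ i = η j - θ j := by
      intro i j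
      rcases lt_trichotomy i j with h | h | h
      · linarith [hall i j h]
      · rw [h]
      · linarith [hall j i h]
    apply hne
    ext i
    have hs : ∑ j, (η j - θ j) = 0 := by rw [Finset.sum_sub_distrib, hη.2, hθ.2]; norm_num
    rw [Finset.sum_congr rfl fun j _ => hall' j i] at hs
    simp only [Finset.sum_const, Finset.card_univ, Fintype.card_fin, nsmul_eq_mul] at hs
    have hd : (d : ℝ) ≠ 0 := by exact_mod_cast (Fin.pos i).ne'
    have := (mul_eq_zero.mp hs).resolve_left hd
    linarith
  have key : 2 * negLogLik (wins ω) m < negLogLik (wins ω) η + negLogLik (wins ω) θ := by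
    have hM : ∀ i j, m i - m j = ((η i - η j) + (θ i - θ j)) / 2 := fun i j => by
      simp only [hm]; ring
    unfold negLogLik
    have hgoal : ∀ S T U : ℝ, S + T < 2 * U → 2 * (-U) < -S + -T := fun _ _ _ _ => by linarith
    apply hgoal
    rw [← Finset.sum_add_distrib, Finset.mul_sum]
    obtain ⟨i, j, hij, hd⟩ := hdiff
    refine Finset.sum_lt_sum (fun p _ => ?_) ⟨⟨(i, j), hij⟩, Finset.mem_univ _, ?_⟩
    · rw [hM, hM]
      have a1 := mul_le_mul_of_nonneg_left (log_midpoint (η p.1.1 - η p.1.2) (θ p.1.1 - θ p.1.2)).1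
        (Nat.cast_nonneg (α := ℝ) (wins ω p.1.1 p.1.2))
      have a2 := mul_le_mul_of_nonneg_left (log_midpoint (η p.1.2 - η p.1.1) (θ p.1.2 - θ p.1.1)).1
        (Nat.cast_nonneg (α := ℝ) (wins ω p.1.2 p.1.1))
      linarith
    · dsimp only
      rw [hM, hM]
      have b1 := log_midpoint (η i - η j) (θ i - θ j)
      have b2 := log_midpoint (η j - η i) (θ j - θ i)
      have hd' : η j - η i ≠ θ j - θ i := fun h => hd (by linarith)
      have a1 := mul_le_mul_of_nonneg_left b1.1 (Nat.cast_nonneg (α := ℝ) (wins ω i j))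
      have a2 := mul_le_mul_of_nonneg_left b2.1 (Nat.cast_nonneg (α := ℝ) (wins ω j i))
      have hsum := wins_add_wins ω hij
      rcases Nat.eq_zero_or_pos (wins ω i j) with h0 | h0
      · have hp : (0 : ℝ) < wins ω j i := by exact_mod_cast (by omega : 0 < wins ω j i)
        have := mul_lt_mul_of_pos_left (b2.2 hd') hp
        linarith
      · have hp : (0 : ℝ) < wins ω i j := by exact_mod_cast h0
        have := mul_lt_mul_of_pos_left (b1.2 hd) hp
        linarith
  have h1 := isMinOn_iff.mp hmin m hmid
  have h2 := isMinOn_iff.mp hηmin m hmid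
  linarith

theorem isBoxMLE_mle {d k : ℕ} {A : ℝ} (hA : 0 ≤ A) (hk : 1 ≤ k) (ω : Outcome d k) :
    IsBoxMLE A ω (mle A ω) :=
  Classical.epsilon_spec (existsUnique_isBoxMLE hA hk ω).exists

end BTL

/-! Write n = dk. The gradient of the loss at η splits as k · `drift` − `noise`: a deterministic
function of η and θ*, and the centered win counts.

Localization. Optimality over the box lets the gradients be compared at the coordinates of largest
and smallest error (`grad_le_grad`). Since σ' is bounded below on bounded sets, this bounds the
sup-norm error by a multiple of max |noise| / n (`mul_abs_error_le`). The noise is sub-Gaussian, so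
outside an event of probability at most 2/n the error is at most τ = `radius`, of order √(log n /
n).

Upper bound. For n large, τ < A − B, so on the typical event the stretched estimator is interior and
its gradient vanishes; hence the mean gradient is O(1). The noise has mean zero, so the mean drift
is O(1/k). Linearizing the drift gives a weighted Laplacian of the bias with remainder O(dτ²), and a
maximum principle (`mul_abs_le_of_abs_laplacian_le`) inverts it: the bias is O(1/n + τ²) = O(log n /
n).

Lower bound. At the spike the first coordinate sits on the boundary, so the estimator can only err
downwards there: its error is at most about the negative part of the noise divided by n. Unlike the
noise itself, the negative part has a mean of order √n (`le_integral_abs_noise`), while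
linearization and exceptional outcomes cost only O(log n). The resulting bias is of order 1/√n. -/

namespace BTL

/-! ### Estimates for the sigmoid -/

/-- σ'(x) = σ(x)σ(−x), and both factors are at least σ(−M) by monotonicity. -/
theorem sigmoid_deriv_bounds {M x : ℝ} (hx : |x| ≤ M) :
    Real.sigmoid (-M) ^ 2 ≤ Real.sigmoid x * (1 - Real.sigmoid x) := by
  have h := abs_le.mp hx
  rw [← Real.sigmoid_neg, sq]
  exact mul_le_mul (Real.sigmoid_le h.1) (Real.sigmoid_le (by linarith [h.2]))
    (Real.sigmoid_nonneg _) (Real.sigmoid_nonneg _)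

theorem sigmoid_slope_le {M x y : ℝ} (hx : -M ≤ x) (hxy : x ≤ y) (hy : y ≤ M) :
    Real.sigmoid (-M) ^ 2 * (y - x) ≤ Real.sigmoid y - Real.sigmoid x := by
  refine (convex_Icc (-M) M).mul_sub_le_image_sub_of_le_deriv continuous_sigmoid.continuousOn
    differentiable_sigmoid.differentiableOn (fun z hz => ?_) x ⟨hx, hxy.trans hy⟩ y
    ⟨hx.trans hxy, hy⟩ hxy
  rw [interior_Icc] at hz
  rw [Real.deriv_sigmoid]
  exact sigmoid_deriv_bounds (abs_le.mpr ⟨hz.1.le, hz.2.le⟩)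

theorem sigmoid_deriv_le_one (x : ℝ) : Real.sigmoid x * (1 - Real.sigmoid x) ≤ 1 := by
  nlinarith [Real.sigmoid_nonneg x, Real.sigmoid_le_one x]

theorem abs_sigmoid_sub_le (x y : ℝ) : |Real.sigmoid y - Real.sigmoid x| ≤ |y - x| := by
  have := convex_univ.norm_image_sub_le_of_norm_deriv_le (f := Real.sigmoid) (C := 1) (x := x)
    (y := y) (fun z _ => differentiable_sigmoid z) (fun z _ => by
      rw [Real.deriv_sigmoid, Real.norm_eq_abs, abs_of_nonneg]
      · exact sigmoid_deriv_le_one z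
      · exact mul_nonneg (Real.sigmoid_nonneg z) (by linarith [Real.sigmoid_le_one z]))
    trivial trivial
  simpa using this

theorem abs_sigmoid_taylor_le (x y : ℝ) :
    |Real.sigmoid y - Real.sigmoid x - Real.sigmoid x * (1 - Real.sigmoid x) * (y - x)| ≤
      (y - x) ^ 2 := by
  set a := Real.sigmoid x * (1 - Real.sigmoid x) with ha
  -- Mean value inequality for σ(z) − σ'(x)z, whose derivative σ'(z) − σ'(x) factors as (σ(z) −
  -- σ(x))(1 − σ(z) − σ(x)).
  have := (convex_uIcc x y).norm_image_sub_le_of_norm_hasDerivWithin_le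
    (f := fun z => Real.sigmoid z - a * z)
    (f' := fun z => Real.sigmoid z * (1 - Real.sigmoid z) - a * 1) (C := |y - x|) (x := x)
    (y := y) (fun z _ => ((Real.hasDerivAt_sigmoid z).sub
      ((hasDerivAt_id z).const_mul a)).hasDerivWithinAt) (fun z hz => by
      have e : Real.sigmoid z * (1 - Real.sigmoid z) - a * 1 =
          (Real.sigmoid z - Real.sigmoid x) * (1 - Real.sigmoid z - Real.sigmoid x) := by
        rw [ha]; ring
      rw [e, Real.norm_eq_abs, abs_mul]
      have h1 : |Real.sigmoid z - Real.sigmoid x| ≤ |y - x| :=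
        (abs_sigmoid_sub_le x z).trans (Set.abs_sub_left_of_mem_uIcc hz)
      have h2 : |1 - Real.sigmoid z - Real.sigmoid x| ≤ 1 := by
        rw [abs_le]
        constructor <;> linarith [Real.sigmoid_nonneg x, Real.sigmoid_nonneg z,
          Real.sigmoid_le_one x, Real.sigmoid_le_one z]
      nlinarith [abs_nonneg (Real.sigmoid z - Real.sigmoid x),
        abs_nonneg (1 - Real.sigmoid z - Real.sigmoid x)])
    Set.left_mem_uIcc Set.right_mem_uIcc
  simp only [Real.norm_eq_abs] at this
  calc _ = |Real.sigmoid y - a * y - (Real.sigmoid x - a * x)| := by congr 1; ring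
    _ ≤ |y - x| * |y - x| := this
    _ = _ := by rw [abs_mul_abs_self]; ring

/-! ### Sums over pairs -/

/-- The signed incidence of the item `i` in the pair `p`. -/
def incidence {d : ℕ} (p : Pair d) (i : Fin d) : ℝ :=
  (if p.1.1 = i then 1 else 0) - (if p.1.2 = i then 1 else 0)

theorem sum_pair {d : ℕ} (g : Fin d × Fin d → ℝ) :
    ∑ p : Pair d, g p.1 = ∑ x, ∑ y, if x < y then g (x, y) else 0 := by
  rw [← Fintype.sum_prod_type' (fun x y => if x < y then g (x, y) else 0), ← Finset.sum_filter]
  exact (Finset.sum_subtype (Finset.univ.filter fun q : Fin d × Fin d => q.1 < q.2)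
    (by simp) g).symm

/-- Antisymmetry removes the ordering i < j: a pair in which i comes second contributes −F j i = F i
j, and the diagonal term F i i vanishes. -/
theorem sum_incidence_mul {d : ℕ} (F : Fin d → Fin d → ℝ) (hF : ∀ x y, F x y = -F y x)
    (i : Fin d) : ∑ p : Pair d, incidence p i * F p.1.1 p.1.2 = ∑ j, F i j := by
  have h := sum_pair (d := d) fun q =>
    ((if q.1 = i then 1 else 0) - (if q.2 = i then 1 else 0)) * F q.1 q.2
  refine h.trans ?_
  have e : ∀ x y : Fin d, (if x < y then
      ((if x = i then (1 : ℝ) else 0) - (if y = i then 1 else 0)) * F x y else 0) =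
      (if x = i then (if x < y then F x y else 0) else 0) -
        (if y = i then (if x < y then F x y else 0) else 0) := by
    intro x y; split_ifs <;> ring
  simp only [e, Finset.sum_sub_distrib]
  rw [Finset.sum_comm (f := fun x y => if x = i then (if x < y then F x y else 0) else 0)]
  simp only [Finset.sum_ite_eq', Finset.mem_univ, if_true]
  rw [← Finset.sum_sub_distrib]
  refine Finset.sum_congr rfl fun j _ => ?_
  rcases lt_trichotomy i j with h | h | h
  · simp [h, h.le]
  · subst h; simp; linarith [hF i i]
  · simp only [h, not_lt.mpr h.le, if_true, if_false]; rw [hF i j]; ring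

theorem sum_incidence_sq {d : ℕ} (i : Fin d) :
    ∑ p : Pair d, incidence p i ^ 2 = (d : ℝ) - 1 := by
  have h := sum_incidence_mul
    (fun x y : Fin d => (if x = i then (1 : ℝ) else 0) - (if y = i then 1 else 0))
    (fun x y => by ring) i
  simp only [sq]
  refine h.trans ?_
  simp

theorem sum_mul_incidence {d : ℕ} (p : Pair d) (v : Fin d → ℝ) :
    ∑ i, v i * incidence p i = v p.1.1 - v p.1.2 := by
  simp [incidence, mul_sub]

/-! ### Gradient of the loss and first-order optimality -/

/-- The gradient of the negative log-likelihood at `η`. -/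
noncomputable def grad {d k : ℕ} (ω : Outcome d k) (η : Fin d → ℝ) (i : Fin d) : ℝ :=
  ∑ p : Pair d, incidence p i * (k * Real.sigmoid (η p.1.1 - η p.1.2) - wins ω p.1.1 p.1.2)

/-- The change in the (normalized) expected number of wins of item `i` from `θ` to `η`. -/
noncomputable def drift {d : ℕ} (θ η : Fin d → ℝ) (i : Fin d) : ℝ :=
  ∑ j, (Real.sigmoid (η i - η j) - Real.sigmoid (θ i - θ j))

/-- The centered number of wins of item `i`. -/
noncomputable def noise {d k : ℕ} (θ : Fin d → ℝ) (ω : Outcome d k) (i : Fin d) : ℝ :=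
  ∑ c : Pair d × Fin k, incidence c.1 i *
    ((if ω c = true then 1 else 0) - Real.sigmoid (θ c.1.1.1 - θ c.1.1.2))

theorem grad_eq {d k : ℕ} (θ : Fin d → ℝ) (ω : Outcome d k) (η : Fin d → ℝ) (i : Fin d) :
    grad ω η i = k * drift θ η i - noise θ ω i := by
  have h := sum_incidence_mul (fun x y => Real.sigmoid (η x - η y) - Real.sigmoid (θ x - θ y))
    (fun x y => by
      rw [← neg_sub (η y), ← neg_sub (θ y), Real.sigmoid_neg, Real.sigmoid_neg]; ring) i
  rw [drift, ← h, noise, Fintype.sum_prod_type, Finset.mul_sum, ← Finset.sum_sub_distrib, grad]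
  refine Finset.sum_congr rfl fun p _ => ?_
  dsimp only
  rw [← Finset.mul_sum, Finset.sum_sub_distrib]
  have hw : (wins ω p.1.1 p.1.2 : ℝ) = ∑ r : Fin k, if ω (p, r) = true then (1 : ℝ) else 0 := by
    rw [wins, dif_pos p.2, Finset.sum_boole]
  rw [hw]
  simp
  ring

theorem sum_grad {d k : ℕ} (ω : Outcome d k) (η : Fin d → ℝ) : ∑ i, grad ω η i = 0 := by
  simp only [grad]
  rw [Finset.sum_comm]
  refine Finset.sum_eq_zero fun p _ => ?_
  rw [← Finset.sum_mul]
  have := sum_mul_incidence p (fun _ => 1)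
  simp only [one_mul, sub_self] at this
  rw [this, zero_mul]

theorem hasDerivAt_negLogLik {d k : ℕ} (ω : Outcome d k) (η v : Fin d → ℝ) :
    HasDerivAt (fun t : ℝ => negLogLik (wins ω) (fun i => η i + t * v i))
      (∑ i, v i * grad ω η i) 0 := by
  have hlog : ∀ x : ℝ, HasDerivAt (fun x => Real.log (1 / (1 + Real.exp (-x))))
      (1 - Real.sigmoid x) x := by
    intro x
    have h := (Real.hasDerivAt_sigmoid x).log (Real.sigmoid_pos x).ne'
    have e : Real.sigmoid x * (1 - Real.sigmoid x) / Real.sigmoid x = 1 - Real.sigmoid x := by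
      field_simp [(Real.sigmoid_pos x).ne']
    rw [e] at h
    simpa [Real.sigmoid_def] using h
  have hlin : ∀ a b : Fin d, HasDerivAt (fun t : ℝ => (η a + t * v a) - (η b + t * v b))
      (v a - v b) 0 := by
    intro a b
    have := (((hasDerivAt_id (0 : ℝ)).mul_const (v a)).const_add (η a)).fun_sub
      (((hasDerivAt_id (0 : ℝ)).mul_const (v b)).const_add (η b))
    simpa using this
  have hcomp : ∀ a b : Fin d, HasDerivAt (fun t : ℝ =>
      Real.log (1 / (1 + Real.exp (-((η a + t * v a) - (η b + t * v b))))))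
      ((1 - Real.sigmoid (η a - η b)) * (v a - v b)) 0 := by
    intro a b
    have h := hlog (η a - η b)
    have e : η a - η b = (η a + 0 * v a) - (η b + 0 * v b) := by ring
    rw [e] at h
    have := HasDerivAt.comp (0 : ℝ) h (hlin a b)
    rw [← e] at this
    exact this
  have := (HasDerivAt.fun_sum (u := Finset.univ) fun (p : Pair d) _ =>
    ((hcomp p.1.1 p.1.2).const_mul (wins ω p.1.1 p.1.2 : ℝ)).fun_add
      ((hcomp p.1.2 p.1.1).const_mul (wins ω p.1.2 p.1.1 : ℝ))).fun_neg
  unfold negLogLik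
  refine this.congr_deriv ?_
  simp only [grad, Finset.mul_sum]
  rw [Finset.sum_comm, ← Finset.sum_neg_distrib]
  refine Finset.sum_congr rfl fun p _ => ?_
  have hk : (wins ω p.1.1 p.1.2 : ℝ) + wins ω p.1.2 p.1.1 = k := by
    exact_mod_cast wins_add_wins ω p.2
  simp only [← mul_assoc]
  rw [← Finset.sum_mul, sum_mul_incidence, ← hk, ← neg_sub (η p.1.1), Real.sigmoid_neg]
  ring

/-- Moving a small mass t > 0 from coordinate i to coordinate j keeps the point in the box, so the
one-sided derivative of the loss in the direction e_j − e_i is nonnegative. -/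
theorem grad_le_grad {d k : ℕ} {A : ℝ} {ω : Outcome d k} {η : Fin d → ℝ} (h : IsBoxMLE A ω η)
    {i j : Fin d} (hi : -A < η i) (hj : η j < A) : grad ω η i ≤ grad ω η j := by
  rcases eq_or_ne i j with rfl | hij
  · exact le_rfl
  have hA : 0 ≤ A := (norm_nonneg _).trans h.1.1
  set v : Fin d → ℝ := Pi.single j 1 - Pi.single i 1 with hv
  have hd := hasDerivAt_negLogLik ω η v
  have hs : ∑ l, v l * grad ω η l = grad ω η j - grad ω η i := by
    simp [hv, sub_mul, Pi.single_apply]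
  rw [hs] at hd
  have htend := (hasDerivWithinAt_iff_tendsto_slope' (s := Set.Ioi (0 : ℝ)) (by simp)).mp
    hd.hasDerivWithinAt
  have hnn : 0 ≤ grad ω η j - grad ω η i := by
    refine ge_of_tendsto htend ?_
    have hpos : 0 < min (η i + A) (A - η j) := lt_min (by linarith) (by linarith)
    filter_upwards [Ioo_mem_nhdsGT hpos] with t ht
    have ht1 := ht.2.trans_le (min_le_left _ _)
    have ht2 := ht.2.trans_le (min_le_right _ _)
    have hb : ∀ l, |η l| ≤ A := fun l => (norm_le_pi_norm η l).trans h.1.1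
    have hmem : (fun l => η l + t * v l) ∈ box d A := by
      refine ⟨(pi_norm_le_iff_of_nonneg hA).mpr fun l => ?_, ?_⟩
      · have hl := abs_le.mp (hb l)
        rw [Real.norm_eq_abs, abs_le]
        have h0 := ht.1
        rcases eq_or_ne l j with rfl | hlj
        · simp [hv, hij.symm]
          constructor <;> linarith
        · rcases eq_or_ne l i with rfl | hli
          · simp [hv, hij]
            constructor <;> linarith
          · simp [hv, hlj, hli]
            exact ⟨by linarith, by linarith⟩
      · rw [Finset.sum_add_distrib, h.1.2, ← Finset.mul_sum]
        simp [hv]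
    have hle := isMinOn_iff.mp h.2 _ hmem
    rw [slope_def_field]
    refine div_nonneg ?_ (by linarith [ht.1])
    simpa using hle
  linarith

/-! ### Sup-norm error in terms of the noise -/

theorem abs_sub_le_of_mem_box {d : ℕ} {A : ℝ} {η : Fin d → ℝ} (h : η ∈ box d A) (i j : Fin d) :
    |η i - η j| ≤ 2 * A := by
  have h1 := abs_le.mp ((norm_le_pi_norm η i).trans h.1)
  have h2 := abs_le.mp ((norm_le_pi_norm η j).trans h.1)
  rw [abs_le]; constructor <;> linarith

/-- At the coordinate of largest error every summand of the drift is an increment of σ over a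
nonnegative step, so the slope bound applies termwise; the zero sums then collapse the total step to
d times the error at i. -/
theorem mul_le_drift {d : ℕ} {A : ℝ} {θ η : Fin d → ℝ} (hθ : θ ∈ box d A) (hη : η ∈ box d A)
    {i : Fin d} (hi : ∀ l, η l - θ l ≤ η i - θ i) :
    Real.sigmoid (-(2 * A)) ^ 2 * (d * (η i - θ i)) ≤ drift θ η i := by
  have e : (d : ℝ) * (η i - θ i) = ∑ l, ((η i - η l) - (θ i - θ l)) := by
    simp only [Finset.sum_sub_distrib, hθ.2, hη.2]; simp; ring
  rw [e, Finset.mul_sum]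
  refine Finset.sum_le_sum fun l _ => sigmoid_slope_le ?_ (by linarith [hi l]) ?_
  · exact (abs_le.mp (abs_sub_le_of_mem_box hθ i l)).1
  · exact (abs_le.mp (abs_sub_le_of_mem_box hη i l)).2

theorem drift_le_mul {d : ℕ} {A : ℝ} {θ η : Fin d → ℝ} (hθ : θ ∈ box d A) (hη : η ∈ box d A)
    {i : Fin d} (hi : ∀ l, η i - θ i ≤ η l - θ l) :
    drift θ η i ≤ Real.sigmoid (-(2 * A)) ^ 2 * (d * (η i - θ i)) := by
  have h := mul_le_drift (θ := η) (η := θ) hη hθ (i := i) (fun l => by linarith [hi l])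
  have e : drift θ η i = -drift η θ i := by
    simp only [drift, ← Finset.sum_neg_distrib, neg_sub]
  rw [e]; linarith

theorem mul_abs_error_le {d k : ℕ} {A t : ℝ} {ω : Outcome d k} {θ η : Fin d → ℝ}
    (hθ : θ ∈ box d A) (h : IsBoxMLE A ω η) (ht : ∀ i, |noise θ ω i| ≤ t) (l : Fin d) :
    Real.sigmoid (-(2 * A)) ^ 2 * (d * k) * |η l - θ l| ≤ 2 * t := by
  set D : Fin d → ℝ := fun l => η l - θ l with hD
  have hsum : ∑ l, D l = 0 := by simp only [hD, Finset.sum_sub_distrib, hθ.2, h.1.2, sub_zero]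
  have : Nonempty (Fin d) := ⟨l⟩
  obtain ⟨i, hi⟩ := Finite.exists_max D
  obtain ⟨j, hj⟩ := Finite.exists_min D
  have hd : (0 : ℝ) < d := by exact_mod_cast l.pos
  -- The terms D i − D m are nonnegative and sum to d · D i; keep only m = j. Hence D i > 0 > D j
  -- unless all errors vanish.
  have h1 : D i - D j ≤ d * D i := by
    have := Finset.single_le_sum (f := fun m => D i - D m)
      (fun m _ => sub_nonneg.mpr (hi m)) (Finset.mem_univ j)
    simpa [Finset.sum_sub_distrib, hsum] using this
  have h2 : D i - D j ≤ -(d * D j) := by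
    have := Finset.single_le_sum (f := fun m => D m - D j)
      (fun m _ => sub_nonneg.mpr (hj m)) (Finset.mem_univ i)
    simpa [Finset.sum_sub_distrib, hsum] using this
  have hij : 0 ≤ D i - D j := by linarith [hi j]
  have hDi : 0 ≤ D i := nonneg_of_mul_nonneg_right (hij.trans h1) hd
  have hDj : D j ≤ 0 := by
    have : 0 ≤ -D j := nonneg_of_mul_nonneg_right (b := -D j) (by linarith) hd
    linarith
  have habs : |D l| ≤ D i - D j := by
    rw [abs_le]; constructor <;> linarith [hi l, hj l]
  have ht0 : 0 ≤ t := (abs_nonneg _).trans (ht l)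
  set c := Real.sigmoid (-(2 * A)) ^ 2 with hc
  have hc0 : 0 ≤ c := by positivity
  have hk0 : (0 : ℝ) ≤ k := Nat.cast_nonneg k
  have main : c * (d * k) * (D i - D j) ≤ 2 * t := by
    rcases hij.eq_or_lt with h0 | hpos
    · rw [← h0]; linarith
    · have hDi' : 0 < D i := pos_of_mul_pos_right (hpos.trans_le h1) hd.le
      have hDj' : 0 < -D j := pos_of_mul_pos_right (b := -D j) (by linarith) hd.le
      have bi := abs_le.mp ((norm_le_pi_norm θ i).trans hθ.1)
      have bj := abs_le.mp ((norm_le_pi_norm θ j).trans hθ.1)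
      -- D i > 0 and D j < 0 keep the estimate off the lower bound at i and off the upper bound at
      -- j, as θ lies in the box.
      have hg := grad_le_grad h (i := i) (j := j)
        (by simp only [hD] at hDi'; linarith) (by simp only [hD] at hDj'; linarith)
      rw [grad_eq θ, grad_eq θ] at hg
      have u1 := mul_le_mul_of_nonneg_left (mul_le_drift hθ h.1 hi) hk0
      have u2 := mul_le_mul_of_nonneg_left (drift_le_mul hθ h.1 hj) hk0
      have s1 := abs_le.mp (ht i)
      have s2 := abs_le.mp (ht j)
      simp only [hD] at *
      linarith
  exact (mul_le_mul_of_nonneg_left habs (by positivity)).trans main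

theorem abs_drift_le {d : ℕ} (θ η : Fin d → ℝ) (i : Fin d) : |drift θ η i| ≤ d := by
  refine (Finset.abs_sum_le_sum_abs _ _).trans ?_
  refine (Finset.sum_le_sum (g := fun _ => (1 : ℝ)) fun j _ => ?_).trans (by simp)
  rw [abs_le]
  constructor <;> linarith [Real.sigmoid_nonneg (η i - η j), Real.sigmoid_nonneg (θ i - θ j),
    Real.sigmoid_le_one (η i - η j), Real.sigmoid_le_one (θ i - θ j)]

theorem abs_noise_le {d k : ℕ} (θ : Fin d → ℝ) (ω : Outcome d k) (i : Fin d) :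
    |noise θ ω i| ≤ d * k := by
  have h1 : |noise θ ω i| ≤ ∑ c : Pair d × Fin k, incidence c.1 i ^ 2 := by
    refine (Finset.abs_sum_le_sum_abs _ _).trans (Finset.sum_le_sum fun c _ => ?_)
    rw [abs_mul]
    have hx : |(if ω c = true then (1 : ℝ) else 0) -
        Real.sigmoid (θ c.1.1.1 - θ c.1.1.2)| ≤ 1 := by
      rw [abs_le]
      constructor <;> split_ifs <;> linarith [Real.sigmoid_nonneg (θ c.1.1.1 - θ c.1.1.2),
        Real.sigmoid_le_one (θ c.1.1.1 - θ c.1.1.2)]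
    -- The incidence takes only the values −1, 0 and 1.
    have hi : |incidence c.1 i| = incidence c.1 i ^ 2 := by
      have := c.1.2.ne
      unfold incidence
      split_ifs with h1 h2 <;> simp_all
    rw [← hi]
    exact mul_le_of_le_one_right (abs_nonneg _) hx
  rw [Fintype.sum_prod_type] at h1
  simp only [Finset.sum_const, Finset.card_univ, Fintype.card_fin, nsmul_eq_mul] at h1
  rw [← Finset.mul_sum, sum_incidence_sq] at h1
  nlinarith [Nat.cast_nonneg (α := ℝ) k]

theorem abs_drift_sub_linear_le {d : ℕ} (θ η : Fin d → ℝ) {τ : ℝ}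
    (h : ∀ l, |η l - θ l| ≤ τ) (i : Fin d) :
    |drift θ η i - ∑ j, Real.sigmoid (θ i - θ j) * (1 - Real.sigmoid (θ i - θ j)) *
      ((η i - θ i) - (η j - θ j))| ≤ d * (4 * τ ^ 2) := by
  rw [drift, ← Finset.sum_sub_distrib]
  refine (Finset.abs_sum_le_sum_abs _ _).trans ?_
  refine (Finset.sum_le_sum (g := fun _ => 4 * τ ^ 2) fun j _ => ?_).trans (by simp)
  have e : (η i - θ i) - (η j - θ j) = (η i - η j) - (θ i - θ j) := by ring
  rw [e]
  refine (abs_sigmoid_taylor_le _ _).trans ?_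
  rw [← e]
  have h1 := abs_le.mp (h i)
  have h2 := abs_le.mp (h j)
  nlinarith

/-! ### Moments and concentration of the noise -/

theorem integrable_law {d k : ℕ} {E : Type*} [NormedAddCommGroup E] (θ : Fin d → ℝ)
    (f : Outcome d k → E) : Integrable f (law k θ) := .of_finite

/-- The centered contribution of the outcome `b` of the comparison `c` to the wins of item `i`. -/
noncomputable def centeredWin {d k : ℕ} (θ : Fin d → ℝ) (i : Fin d) (c : Pair d × Fin k)
    (b : Bool) : ℝ :=
  incidence c.1 i * ((if b = true then 1 else 0) - Real.sigmoid (θ c.1.1.1 - θ c.1.1.2))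

theorem noise_eq_sum {d k : ℕ} (θ : Fin d → ℝ) (ω : Outcome d k) (i : Fin d) :
    noise θ ω i = ∑ c, centeredWin θ i c (ω c) := rfl

theorem coe_sigmoid (x : ℝ) : (unitInterval.sigmoid x : ℝ) = Real.sigmoid x := rfl

theorem integral_law_eval {d k : ℕ} (θ : Fin d → ℝ) (c : Pair d × Fin k) (f : Bool → ℝ) :
    ∫ ω : Outcome d k, f (ω c) ∂(law k θ) =
      Real.sigmoid (θ c.1.1.1 - θ c.1.1.2) * f true +
        (1 - Real.sigmoid (θ c.1.1.1 - θ c.1.1.2)) * f false :=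
  (integral_comp_eval (i := c) (f := f) (μ := fun c : Pair d × Fin k =>
    bernoulliMeasure true false (unitInterval.sigmoid (θ c.1.1.1 - θ c.1.1.2)))
    .of_discrete).trans (integral_bernoulliMeasure _ _ _ _)

theorem integral_centeredWin {d k : ℕ} (θ : Fin d → ℝ) (i : Fin d) (c : Pair d × Fin k) :
    ∫ b, centeredWin θ i c b ∂(bernoulliMeasure true false
      (unitInterval.sigmoid (θ c.1.1.1 - θ c.1.1.2))) = 0 := by
  refine (integral_bernoulliMeasure _ _ _ _).trans ?_
  simp only [centeredWin, coe_sigmoid, smul_eq_mul, if_true, Bool.false_eq_true, if_false]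
  ring

theorem integral_centeredWin_sq {d k : ℕ} (θ : Fin d → ℝ) (i : Fin d) (c : Pair d × Fin k) :
    ∫ b, centeredWin θ i c b ^ 2 ∂(bernoulliMeasure true false
      (unitInterval.sigmoid (θ c.1.1.1 - θ c.1.1.2))) =
    incidence c.1 i ^ 2 * (Real.sigmoid (θ c.1.1.1 - θ c.1.1.2) *
      (1 - Real.sigmoid (θ c.1.1.1 - θ c.1.1.2))) := by
  refine (integral_bernoulliMeasure _ _ _ _).trans ?_
  simp only [centeredWin, coe_sigmoid, smul_eq_mul, if_true, Bool.false_eq_true, if_false]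
  ring

theorem integral_noise {d k : ℕ} (θ : Fin d → ℝ) (i : Fin d) :
    ∫ ω : Outcome d k, noise θ ω i ∂(law k θ) = 0 := by
  simp only [noise_eq_sum]
  rw [integral_finsetSum _ fun c _ => integrable_law θ _]
  refine Finset.sum_eq_zero fun c _ => ?_
  rw [integral_law_eval]
  simp only [centeredWin, if_true, Bool.false_eq_true, if_false]
  ring

theorem integral_noise_sq {d k : ℕ} (θ : Fin d → ℝ) (i : Fin d) :
    ∫ ω : Outcome d k, noise θ ω i ^ 2 ∂(law k θ) =
      ∑ c : Pair d × Fin k, incidence c.1 i ^ 2 * (Real.sigmoid (θ c.1.1.1 - θ c.1.1.2) *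
      (1 - Real.sigmoid (θ c.1.1.1 - θ c.1.1.2))) := by
  rw [← variance_of_integral_eq_zero .of_discrete (integral_noise θ i)]
  have h := variance_sum_pi (X := centeredWin (k := k) θ i)
    (μ := fun c : Pair d × Fin k =>
      bernoulliMeasure true false (unitInterval.sigmoid (θ c.1.1.1 - θ c.1.1.2)))
    (fun c => .of_discrete)
  have e : (fun ω : Outcome d k => noise θ ω i) =
      ∑ c, fun ω : Outcome d k => centeredWin θ i c (ω c) := by
    ext ω; rw [noise_eq_sum, Finset.sum_apply]
  rw [e]
  refine h.trans (Finset.sum_congr rfl fun c _ => ?_)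
  rw [variance_of_integral_eq_zero .of_discrete (integral_centeredWin θ i c),
    integral_centeredWin_sq]

theorem hasSubgaussianMGF_noise {d k : ℕ} (θ : Fin d → ℝ) (i : Fin d) :
    ∃ c : NNReal, (c : ℝ) = ((d : ℝ) - 1) * k / 4 ∧
      HasSubgaussianMGF (fun ω : Outcome d k => noise θ ω i) c (law k θ) := by
  have hind : iIndepFun (fun (c : Pair d × Fin k) (ω : Outcome d k) =>
      (incidence c.1 i) * ((if ω c = true then (1 : ℝ) else 0) -
        Real.sigmoid (θ c.1.1.1 - θ c.1.1.2))) (law k θ) :=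
    iIndepFun_pi (X := fun c => centeredWin θ i c) (fun c => .of_discrete)
  have hsub : ∀ c : Pair d × Fin k, HasSubgaussianMGF (fun ω : Outcome d k =>
      (incidence c.1 i) * ((if ω c = true then (1 : ℝ) else 0) -
        Real.sigmoid (θ c.1.1.1 - θ c.1.1.2))) (‖incidence c.1 i‖₊ ^ 2 *
          (1 / 2) ^ 2) (law k θ) := by
    intro c
    set s := Real.sigmoid (θ c.1.1.1 - θ c.1.1.2) with hs
    have h0 : ∫ ω : Outcome d k, ((if ω c = true then (1 : ℝ) else 0) - s) ∂(law k θ) = 0 := by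
      rw [integral_law_eval θ c fun b : Bool => (if b = true then (1 : ℝ) else 0) - s]
      simp only [← hs, if_true, Bool.false_eq_true, if_false]
      ring
    -- Hoeffding's lemma on an interval of length 1 gives the parameter 1/4; exactly (d − 1)k
    -- comparisons involve item i.
    have h := hasSubgaussianMGF_of_mem_Icc_of_integral_eq_zero (a := -s) (b := 1 - s)
      (μ := law k θ) (X := fun ω : Outcome d k => (if ω c = true then (1 : ℝ) else 0) - s)
      .of_discrete (Filter.Eventually.of_forall fun ω => by
        rw [Set.mem_Icc]; constructor <;> split_ifs <;> linarith) h0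
    have e : ‖(1 - s) - -s‖₊ / 2 = 1 / 2 := by simp
    rw [e] at h
    refine Eq.mp (congrArg (fun q : NNReal => HasSubgaussianMGF _ q (law k θ)) (NNReal.eq ?_))
      (h.const_mul (incidence c.1 i))
    have e' : incidence c.1 i ^ 2 * (((1 / 2) ^ 2 : NNReal) : ℝ) =
        ((‖incidence c.1 i‖₊ ^ 2 * (1 / 2) ^ 2 : NNReal) : ℝ) := by simp
    exact e'
  refine ⟨_, ?_, HasSubgaussianMGF.sum_of_iIndepFun hind (s := Finset.univ) fun c _ => hsub c⟩
  push_cast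
  rw [← Finset.sum_mul, Fintype.sum_prod_type]
  simp only [Real.norm_eq_abs, sq_abs, Finset.sum_const, Finset.card_univ, Fintype.card_fin, nsmul_eq_mul]
  rw [← Finset.mul_sum, sum_incidence_sq]
  ring

theorem measureReal_noise_gt_le {d k : ℕ} (hd : 2 ≤ d) (hk : 1 ≤ k) (θ : Fin d → ℝ) (i : Fin d)
    {s : ℝ} (hs : 0 ≤ s) :
    (law k θ).real {ω | s < |noise θ ω i|} ≤ 2 * Real.exp (-(2 * s ^ 2 / (d * k))) := by
  obtain ⟨c, hc, hsub⟩ := hasSubgaussianMGF_noise (k := k) θ i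
  have hd' : (2 : ℝ) ≤ d := by exact_mod_cast hd
  have hk' : (1 : ℝ) ≤ k := by exact_mod_cast hk
  have hexp : Real.exp (-s ^ 2 / (2 * c)) ≤ Real.exp (-(2 * s ^ 2 / (d * k))) := by
    rw [hc, Real.exp_le_exp, neg_div, neg_le_neg_iff]
    have hpos : 0 < ((d : ℝ) - 1) * k := by apply mul_pos <;> linarith
    have e : s ^ 2 / (2 * (((d : ℝ) - 1) * k / 4)) = 2 * s ^ 2 / (((d : ℝ) - 1) * k) := by
      field_simp; ring
    rw [e]
    gcongr
    linarith
  have h1 := (hsub.measure_ge_le hs).trans hexp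
  have h2 := (hsub.neg.measure_ge_le hs).trans hexp
  have hset : {ω : Outcome d k | s < |noise θ ω i|} ⊆
      {ω | s ≤ noise θ ω i} ∪ {ω | s ≤ (-fun ω : Outcome d k => noise θ ω i) ω} := by
    intro ω hω
    rcases lt_abs.mp (show s < |noise θ ω i| from hω) with h | h
    · exact Or.inl h.le
    · exact Or.inr h.le
  have := (measureReal_mono (μ := law k θ) hset).trans (measureReal_union_le _ _)
  linarith

/-- The event that no item has an exceptional number of wins. -/
def typical {d : ℕ} (k : ℕ) (θ : Fin d → ℝ) : Set (Outcome d k) :=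
  {ω | ∀ i, |noise θ ω i| ≤ Real.sqrt ((d * k) * Real.log (d * k))}

theorem measureReal_typical_compl_le {d k : ℕ} (hd : 2 ≤ d) (hk : 1 ≤ k) (θ : Fin d → ℝ) :
    (law k θ).real (typical k θ)ᶜ ≤ 2 / (d * k) := by
  set n : ℝ := d * k with hn
  have hd' : (2 : ℝ) ≤ d := by exact_mod_cast hd
  have hk' : (1 : ℝ) ≤ k := by exact_mod_cast hk
  have hdn : (d : ℝ) ≤ n := by rw [hn]; nlinarith
  have hn0 : 0 < n := by linarith
  have hset : (typical k θ)ᶜ = ⋃ i, {ω : Outcome d k | Real.sqrt (n * Real.log n) <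
      |noise θ ω i|} := by
    ext ω; simp [typical, hn]
  rw [hset]
  refine (measureReal_iUnion_fintype_le _).trans ?_
  have hlog : 0 ≤ Real.log n := Real.log_nonneg (by linarith)
  -- The threshold √(n log n) makes each tail at most 2/n², so the union over d ≤ n items costs at
  -- most 2/n.
  have hval : Real.exp (-(2 * Real.sqrt (n * Real.log n) ^ 2 / n)) = 1 / n ^ 2 := by
    rw [Real.sq_sqrt (by positivity)]
    have : -(2 * (n * Real.log n) / n) = -(Real.log n + Real.log n) := by field_simp; ring
    rw [this, Real.exp_neg, Real.exp_add, Real.exp_log hn0, one_div, sq]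
  refine (Finset.sum_le_sum fun i _ =>
    measureReal_noise_gt_le hd hk θ i (Real.sqrt_nonneg (n * Real.log n))).trans ?_
  rw [← hn, hval]
  simp only [Finset.sum_const, Finset.card_univ, Fintype.card_fin, nsmul_eq_mul]
  rw [mul_one_div, mul_div_assoc', div_le_div_iff₀ (by positivity) hn0]
  nlinarith

theorem integral_noise_pow_four_le {d k : ℕ} (hd : 2 ≤ d) (hk : 1 ≤ k) (θ : Fin d → ℝ)
    (i : Fin d) :
    ∫ ω : Outcome d k, noise θ ω i ^ 4 ∂(law k θ) ≤ 6 * (d * k : ℝ) ^ 2 := by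
  obtain ⟨c, hc, hsub⟩ := hasSubgaussianMGF_noise (k := k) θ i
  set n : ℝ := d * k with hn
  have hd' : (2 : ℝ) ≤ d := by exact_mod_cast hd
  have hk' : (1 : ℝ) ≤ k := by exact_mod_cast hk
  have hn0 : 0 < n := by rw [hn]; positivity
  -- With this scale the sub-Gaussian exponent c t² / 2 is at most 1/2, so both exponential moments
  -- are at most 2.
  set t : ℝ := 2 / Real.sqrt n with ht
  have htsq : t ^ 2 = 4 / n := by rw [ht, div_pow, Real.sq_sqrt hn0.le]; norm_num
  have ht0 : 0 < t := by rw [ht]; positivity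
  have hct : (c : ℝ) * t ^ 2 / 2 ≤ 1 / 2 := by
    rw [hc, htsq]
    have : ((d : ℝ) - 1) * k ≤ n := by rw [hn]; nlinarith
    have h4 : ((d : ℝ) - 1) * k / n ≤ 1 := (div_le_one hn0).mpr this
    calc ((d : ℝ) - 1) * k / 4 * (4 / n) / 2 = (((d : ℝ) - 1) * k / n) / 2 := by
          field_simp
      _ ≤ _ := by linarith
  have hexp : Real.exp (1 / 2) ≤ 2 := by
    have h1 := Real.exp_one_lt_d9
    have h2 : Real.exp (1 / 2) ^ 2 = Real.exp 1 := by
      rw [← Real.exp_nat_mul]; norm_num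
    nlinarith [Real.exp_pos (1 / 2)]
  have hm : ∀ u : ℝ, u ^ 2 = t ^ 2 →
      ∫ ω : Outcome d k, Real.exp (u * noise θ ω i) ∂(law k θ) ≤ 2 := by
    intro u hu
    have := hsub.mgf_le u
    rw [mgf, hu] at this
    exact (this.trans (Real.exp_le_exp.mpr hct)).trans hexp
  have hpt : ∀ x : ℝ, x ^ 4 ≤ 24 / t ^ 4 * (Real.exp (t * x) + Real.exp (-t * x)) := by
    intro x
    have h := Real.pow_div_factorial_le_exp _ (abs_nonneg (t * x)) 4
    have h2 : Real.exp |t * x| ≤ Real.exp (t * x) + Real.exp (-t * x) := by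
      rw [neg_mul]; exact Real.exp_abs_le _
    have h3 : |t * x| ^ 4 = t ^ 4 * x ^ 4 := by
      rw [← mul_pow, Even.pow_abs (by decide)]
    have h4 : ((Nat.factorial 4 : ℕ) : ℝ) = 24 := by norm_num [Nat.factorial]
    rw [h3, h4] at h
    rw [div_mul_eq_mul_div, le_div_iff₀ (by positivity)]
    linarith
  calc ∫ ω : Outcome d k, noise θ ω i ^ 4 ∂(law k θ)
      ≤ ∫ ω : Outcome d k, 24 / t ^ 4 * (Real.exp (t * noise θ ω i) +
          Real.exp (-t * noise θ ω i)) ∂(law k θ) :=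
        integral_mono (integrable_law θ _) (integrable_law θ _) fun ω => hpt _
    _ ≤ 24 / t ^ 4 * (2 + 2) := by
        rw [integral_const_mul, integral_add (integrable_law θ _) (integrable_law θ _)]
        gcongr
        · exact hm t rfl
        · exact hm (-t) (by ring)
    _ = 6 * n ^ 2 := by
        have : t ^ 4 = 16 / n ^ 2 := by
          rw [show t ^ 4 = (t ^ 2) ^ 2 by ring, htsq, div_pow]; norm_num
        rw [this]; field_simp; norm_num

/-- A second moment of order n and a fourth moment of order n² force a first absolute moment of
order √n, through the pointwise bound x²/a − x⁴/(4a³) ≤ |x|. -/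
theorem le_integral_abs_noise {d k : ℕ} (hd : 2 ≤ d) (hk : 1 ≤ k) {A : ℝ} {θ : Fin d → ℝ}
    (hθ : θ ∈ box d A) (i : Fin d) :
    Real.sigmoid (-(2 * A)) ^ 4 / 9 * Real.sqrt (d * k) ≤
      ∫ ω : Outcome d k, |noise θ ω i| ∂(law k θ) := by
  set n : ℝ := d * k with hn
  set c := Real.sigmoid (-(2 * A)) ^ 2 with hc
  have hd' : (2 : ℝ) ≤ d := by exact_mod_cast hd
  have hk' : (1 : ℝ) ≤ k := by exact_mod_cast hk
  have hn0 : 0 < n := by rw [hn]; positivity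
  have hc0 : 0 < c := by have := Real.sigmoid_pos (-(2 * A)); positivity
  have hc1 : c ≤ 1 := pow_le_one₀ (Real.sigmoid_nonneg _) (Real.sigmoid_le_one _)
  have h2 : n * c / 2 ≤ ∫ ω : Outcome d k, noise θ ω i ^ 2 ∂(law k θ) := by
    rw [integral_noise_sq]
    have : ∑ c' : Pair d × Fin k, incidence c'.1 i ^ 2 * c = ((d : ℝ) - 1) * k * c := by
      rw [← Finset.sum_mul, Fintype.sum_prod_type]
      simp only [Finset.sum_const, Finset.card_univ, Fintype.card_fin, nsmul_eq_mul]
      rw [← Finset.mul_sum, sum_incidence_sq]; ring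
    calc n * c / 2 ≤ ((d : ℝ) - 1) * k * c := by
          have h0 : 0 ≤ (k : ℝ) * c * (d - 2) :=
            mul_nonneg (by positivity) (by linarith)
          rw [hn]; linarith
      _ = _ := this.symm
      _ ≤ _ := Finset.sum_le_sum fun p _ => mul_le_mul_of_nonneg_left
          (sigmoid_deriv_bounds (abs_sub_le_of_mem_box hθ _ _)) (sq_nonneg _)
  have h4 := integral_noise_pow_four_le hd hk θ i
  rw [← hn] at h4
  -- For a = λ√n/c the two moment terms are c²√n/(2λ) and 3c³√n/(2λ³); λ = 3 maximizes 1/(2λ) −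
  -- 3/(2λ³), which equals 1/9 there.
  set a : ℝ := 3 * Real.sqrt n / c with ha
  have ha0 : 0 < a := by positivity
  have hpt : ∀ x : ℝ, x ^ 2 / a - x ^ 4 / (4 * a ^ 3) ≤ |x| := by
    intro x
    set y := |x| / a with hy
    have hy0 : 0 ≤ y := by positivity
    have hxy : |x| = a * y := by rw [hy]; field_simp
    have e2 : x ^ 2 = (a * y) ^ 2 := by rw [← hxy, sq_abs]
    have e4 : x ^ 4 = (a * y) ^ 4 := by rw [← hxy, Even.pow_abs (by decide)]
    rw [hxy, e2, e4]
    have hpoly : 0 ≤ 4 - 4 * y + y ^ 3 := by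
      nlinarith [sq_nonneg (y - 1), mul_nonneg hy0 (sq_nonneg (y - 1)),
        sq_nonneg (2 * y - 2), mul_nonneg hy0 (sq_nonneg (y - 6 / 5)), sq_nonneg (y - 6 / 5)]
    have : a * y - ((a * y) ^ 2 / a - (a * y) ^ 4 / (4 * a ^ 3)) =
        a * y / 4 * (4 - 4 * y + y ^ 3) := by field_simp; ring
    have h0 : 0 ≤ a * y / 4 * (4 - 4 * y + y ^ 3) := by positivity
    linarith
  have hint : (∫ ω : Outcome d k, noise θ ω i ^ 2 ∂(law k θ)) / a -
      (∫ ω : Outcome d k, noise θ ω i ^ 4 ∂(law k θ)) / (4 * a ^ 3) ≤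
      ∫ ω : Outcome d k, |noise θ ω i| ∂(law k θ) := by
    rw [← integral_div, ← integral_div, ← integral_sub (integrable_law θ _) (integrable_law θ _)]
    exact integral_mono (integrable_law θ _) (integrable_law θ _) fun ω => hpt _
  refine le_trans ?_ hint
  have hs : Real.sqrt n ^ 2 = n := Real.sq_sqrt hn0.le
  have hs0 : 0 < Real.sqrt n := Real.sqrt_pos.mpr hn0
  have b2 : n * c / 2 / a ≤ (∫ ω : Outcome d k, noise θ ω i ^ 2 ∂(law k θ)) / a := by gcongr
  have b4 : (∫ ω : Outcome d k, noise θ ω i ^ 4 ∂(law k θ)) / (4 * a ^ 3) ≤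
      6 * n ^ 2 / (4 * a ^ 3) := by gcongr
  have e1 : n * c / 2 / a = Real.sqrt n * c ^ 2 / 6 := by
    rw [ha]; nth_rewrite 1 [← hs]; field_simp; norm_num
  have e2 : 6 * n ^ 2 / (4 * a ^ 3) = Real.sqrt n * c ^ 3 / 18 := by
    rw [ha]; nth_rewrite 1 [← hs]; field_simp; norm_num
  have hc3 : c ^ 3 ≤ c ^ 2 := pow_le_pow_of_le_one hc0.le hc1 (by norm_num)
  have e3 : Real.sigmoid (-(2 * A)) ^ 4 = c ^ 2 := by rw [hc]; ring
  rw [e3]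
  nlinarith [mul_le_mul_of_nonneg_left hc3 hs0.le]

/-! ### Reduction to the typical event -/

theorem box_subset_box {d : ℕ} {A B : ℝ} (h : B ≤ A) : box d B ⊆ box d A :=
  fun _ hθ => ⟨hθ.1.trans h, hθ.2⟩

/-- The error of the maximum likelihood estimator on the typical event. -/
noncomputable def radius (A n : ℝ) : ℝ :=
  2 * Real.sqrt (n * Real.log n) / (Real.sigmoid (-(2 * A)) ^ 2 * n)

theorem radius_sq {A n : ℝ} (hn : 1 ≤ n) :
    radius A n ^ 2 = 4 * Real.log n / (Real.sigmoid (-(2 * A)) ^ 4 * n) := by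
  have h0 := Real.sigmoid_pos (-(2 * A))
  have hl := Real.log_nonneg hn
  rw [radius, div_pow, mul_pow, Real.sq_sqrt (by positivity)]
  field_simp
  ring

theorem abs_mle_sub_le_radius {d k : ℕ} (hd : 1 ≤ d) (hk : 1 ≤ k) {A : ℝ} (hA : 0 ≤ A)
    {θ : Fin d → ℝ} (hθ : θ ∈ box d A) {ω : Outcome d k} (hω : ω ∈ typical k θ) (i : Fin d) :
    |mle A ω i - θ i| ≤ radius A (d * k) := by
  have h := mul_abs_error_le hθ (isBoxMLE_mle hA hk ω) hω i
  have hd' : (1 : ℝ) ≤ d := by exact_mod_cast hd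
  have hk' : (1 : ℝ) ≤ k := by exact_mod_cast hk
  have h0 := Real.sigmoid_pos (-(2 * A))
  rw [radius, le_div_iff₀ (by positivity)]
  linarith

theorem integral_le_of_typical {d k : ℕ} (hd : 2 ≤ d) (hk : 1 ≤ k) {θ : Fin d → ℝ}
    {f g : Outcome d k → ℝ} {b : ℝ} (hb : 0 ≤ b) (hf : ∀ ω ∈ typical k θ, f ω ≤ g ω)
    (hf' : ∀ ω, f ω ≤ g ω + b) :
    ∫ ω, f ω ∂(law k θ) ≤ ∫ ω, g ω ∂(law k θ) + 2 * b / (d * k) := by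
  have h : ∫ ω, f ω ∂(law k θ) ≤
      ∫ ω, (g ω + (typical k θ)ᶜ.indicator (fun _ => b) ω) ∂(law k θ) := by
    refine integral_mono (integrable_law θ _) (integrable_law θ _) fun ω => ?_
    by_cases hω : ω ∈ typical k θ
    · simpa [hω] using hf ω hω
    · simpa [hω] using hf' ω
  refine h.trans ?_
  rw [integral_add (integrable_law θ _) (integrable_law θ _),
    integral_indicator_const _ .of_discrete, smul_eq_mul]
  have := mul_le_mul_of_nonneg_right (measureReal_typical_compl_le hd hk θ) hb
  have e : 2 / ((d : ℝ) * k) * b = 2 * b / (d * k) := by ring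
  linarith

theorem abs_integral_le_of_typical {d k : ℕ} (hd : 2 ≤ d) (hk : 1 ≤ k) {θ : Fin d → ℝ}
    {f : Outcome d k → ℝ} {a b : ℝ} (ha : 0 ≤ a) (hb : 0 ≤ b)
    (hf : ∀ ω ∈ typical k θ, |f ω| ≤ a) (hf' : ∀ ω, |f ω| ≤ b) :
    |∫ ω, f ω ∂(law k θ)| ≤ a + 2 * b / (d * k) := by
  refine (abs_integral_le_integral_abs).trans ?_
  have := integral_le_of_typical hd hk (θ := θ) (f := fun ω => |f ω|) (g := fun _ => a) hb hf
    (fun ω => by linarith [hf' ω])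
  simpa using this

/-! ### Maximum principle and the bias of the stretched estimator -/

/-- At a maximizer of b all differences are nonnegative, so the weights may be lowered to c; as b
sums to zero, the sum is then c · d · max b. -/
theorem mul_le_of_laplacian_le {d : ℕ} {w : Fin d → Fin d → ℝ} {b : Fin d → ℝ} {c R : ℝ}
    (hw : ∀ i j, c ≤ w i j) (hb : ∑ i, b i = 0) (hc : 0 ≤ c)
    (h : ∀ i, ∑ j, w i j * (b i - b j) ≤ R) (i : Fin d) : c * d * b i ≤ R := by
  have : Nonempty (Fin d) := ⟨i⟩
  obtain ⟨m, hm⟩ := Finite.exists_max b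
  have h1 : c * d * b m ≤ R := by
    refine le_trans ?_ (h m)
    have e : c * d * b m = ∑ j, c * (b m - b j) := by
      rw [← Finset.mul_sum, Finset.sum_sub_distrib, hb]; simp; ring
    rw [e]
    exact Finset.sum_le_sum fun j _ =>
      mul_le_mul_of_nonneg_right (hw m j) (sub_nonneg.mpr (hm j))
  exact (mul_le_mul_of_nonneg_left (hm i) (by positivity)).trans h1

theorem mul_abs_le_of_abs_laplacian_le {d : ℕ} {w : Fin d → Fin d → ℝ} {b : Fin d → ℝ} {c R : ℝ}
    (hw : ∀ i j, c ≤ w i j) (hb : ∑ i, b i = 0) (hc : 0 ≤ c)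
    (h : ∀ i, |∑ j, w i j * (b i - b j)| ≤ R) (i : Fin d) : c * d * |b i| ≤ R := by
  have h1 := mul_le_of_laplacian_le hw hb hc (fun i => (abs_le.mp (h i)).2) i
  have h2 := mul_le_of_laplacian_le (b := fun i => -b i) (R := R) hw (by simp [hb]) hc
    (fun i => by
      have e : ∑ j, w i j * (-b i - -b j) = -∑ j, w i j * (b i - b j) := by
        rw [← Finset.sum_neg_distrib]; exact Finset.sum_congr rfl fun j _ => by ring
      rw [e]; linarith [(abs_le.mp (h i)).1]) i
  rcases abs_cases (b i) with ⟨e, _⟩ | ⟨e, _⟩ <;> rw [e] <;> assumption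

theorem grad_eq_zero_of_interior {d k : ℕ} {A : ℝ} {ω : Outcome d k} {η : Fin d → ℝ}
    (h : IsBoxMLE A ω η) (hint : ∀ i, |η i| < A) (i : Fin d) : grad ω η i = 0 := by
  have hi : ∀ j, grad ω η j = grad ω η i := fun j => le_antisymm
    (grad_le_grad h (abs_lt.mp (hint j)).1 (abs_lt.mp (hint i)).2)
    (grad_le_grad h (abs_lt.mp (hint i)).1 (abs_lt.mp (hint j)).2)
  have hs := sum_grad ω η
  simp only [hi, Finset.sum_const, Finset.card_univ, Fintype.card_fin, nsmul_eq_mul] at hs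
  exact (mul_eq_zero.mp hs).resolve_left (by exact_mod_cast i.pos.ne')

theorem abs_integral_mle_sub_le {d k : ℕ} (hd : 3 ≤ d) (hk : 1 ≤ k) {A B : ℝ} (hB : 0 < B)
    (hBA : B < A) (hr : radius A (d * k) < A - B) {θ : Fin d → ℝ} (hθ : θ ∈ box d B)
    (i : Fin d) :
    |(∫ ω : Outcome d k, mle A ω i ∂(law k θ)) - θ i| ≤
      ((4 + 32 * A ^ 2) / Real.sigmoid (-(2 * A)) ^ 2 + 16 / Real.sigmoid (-(2 * A)) ^ 6) *
        (Real.log (d * k) / (d * k)) := by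
  have hA : 0 ≤ A := by linarith
  have hθA := box_subset_box hBA.le hθ
  have hd' : (3 : ℝ) ≤ d := by exact_mod_cast hd
  have hk' : (1 : ℝ) ≤ k := by exact_mod_cast hk
  have hmle := fun ω : Outcome d k => isBoxMLE_mle hA hk ω
  set n : ℝ := d * k with hn
  set s := Real.sigmoid (-(2 * A)) with hs
  have hs0 : 0 < s := Real.sigmoid_pos _
  have hn3 : 3 ≤ n := by rw [hn]; nlinarith
  have hlog : 1 ≤ Real.log n := by
    rw [Real.le_log_iff_exp_le (by linarith)]
    exact (Real.exp_one_lt_d9.le.trans (by norm_num)).trans hn3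
  set τ := radius A n with hτ
  have hτ2 : τ ^ 2 = 4 * Real.log n / (s ^ 4 * n) := radius_sq (by linarith)
  have herr : ∀ ω ∈ typical k θ, ∀ l, |mle A ω l - θ l| ≤ τ := fun ω hω l =>
    abs_mle_sub_le_radius (by omega) hk hA hθA hω l
  -- The gradient vanishes on the typical event and is at most 2n elsewhere, an event of probability
  -- at most 2/n.
  have hgrad : ∀ l, |∫ ω : Outcome d k, grad ω (mle A ω) l ∂(law k θ)| ≤ 4 := by
    intro l
    have := abs_integral_le_of_typical (by omega) hk (θ := θ)
      (f := fun ω : Outcome d k => grad ω (mle A ω) l) (a := 0) (b := 2 * n) le_rfl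
      (by linarith) (fun ω hω => by
        rw [grad_eq_zero_of_interior (hmle ω) (fun m => ?_) l, abs_zero]
        have h1 := herr ω hω m
        have h2 : |θ m| ≤ B := (norm_le_pi_norm θ m).trans hθ.1
        have h3 := abs_sub_abs_le_abs_sub (mle A ω m) (θ m)
        linarith) (fun ω => by
        rw [grad_eq θ]
        have h1 := abs_noise_le θ ω l
        have h2 := mul_le_mul_of_nonneg_left (abs_drift_le θ (mle A ω) l)
          (Nat.cast_nonneg (α := ℝ) k)
        refine (abs_sub _ _).trans ?_
        rw [abs_mul, Nat.abs_cast]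
        linarith)
    refine this.trans (le_of_eq ?_)
    rw [← hn]; field_simp; norm_num
  have hdrift : ∀ l, |∫ ω : Outcome d k, drift θ (mle A ω) l ∂(law k θ)| ≤ 4 / k := by
    intro l
    have h := hgrad l
    simp only [grad_eq θ] at h
    rw [integral_sub (integrable_law θ _) (integrable_law θ _), integral_noise, sub_zero,
      integral_const_mul, abs_mul, Nat.abs_cast] at h
    rw [le_div_iff₀ (by linarith)]
    linarith
  set w : Fin d → Fin d → ℝ := fun i j =>
    Real.sigmoid (θ i - θ j) * (1 - Real.sigmoid (θ i - θ j)) with hw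
  set b : Fin d → ℝ := fun i => (∫ ω : Outcome d k, mle A ω i ∂(law k θ)) - θ i with hb
  have hbsum : ∑ i, b i = 0 := by
    simp only [hb, Finset.sum_sub_distrib, hθ.2]
    rw [← integral_finsetSum _ fun c _ => integrable_law θ _]
    simp only [(hmle _).1.2]
    simp
  have hlin : ∀ l, ∑ j, w l j * (b l - b j) = ∫ ω : Outcome d k,
      ∑ j, w l j * ((mle A ω l - θ l) - (mle A ω j - θ j)) ∂(law k θ) := by
    intro l
    rw [integral_finsetSum _ fun c _ => integrable_law θ _]
    refine Finset.sum_congr rfl fun j _ => ?_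
    rw [integral_const_mul, integral_sub (integrable_law θ _) (integrable_law θ _),
      integral_sub (integrable_law θ _) (integrable_law θ _),
      integral_sub (integrable_law θ _) (integrable_law θ _)]
    simp [hb]
  -- The Taylor remainder is taken with error τ on the typical event and with the trivial error 2A
  -- elsewhere.
  have hlap : ∀ l, |∑ j, w l j * (b l - b j)| ≤ 4 / k + (d * (4 * τ ^ 2) +
      2 * (d * (4 * (2 * A) ^ 2)) / n) := by
    intro l
    have h := abs_integral_le_of_typical (by omega) hk (θ := θ)
      (f := fun ω : Outcome d k => drift θ (mle A ω) l -
        ∑ j, w l j * ((mle A ω l - θ l) - (mle A ω j - θ j)))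
      (a := d * (4 * τ ^ 2)) (b := d * (4 * (2 * A) ^ 2)) (by positivity) (by positivity)
      (fun ω hω => abs_drift_sub_linear_le θ _ (herr ω hω) l)
      (fun ω => abs_drift_sub_linear_le θ _ (fun m => by
        have h1 : |θ m| ≤ A := (norm_le_pi_norm θ m).trans hθA.1
        have h2 : |mle A ω m| ≤ A := (norm_le_pi_norm _ m).trans (hmle ω).1.1
        exact (abs_sub _ _).trans (by linarith)) l)
    rw [integral_sub (integrable_law θ _) (integrable_law θ _), ← hlin] at h
    have h1 := abs_le.mp h
    have h2 := abs_le.mp (hdrift l)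
    rw [← hn] at h1
    rw [abs_le]; constructor <;> linarith
  have hfin := mul_abs_le_of_abs_laplacian_le (c := s ^ 2)
    (fun i j => sigmoid_deriv_bounds (abs_sub_le_of_mem_box hθA i j)) hbsum (by positivity)
    hlap i
  rw [hτ2] at hfin
  have hd0 : (0 : ℝ) < d := by linarith
  have hk0 : (0 : ℝ) < k := by linarith
  -- The factor 1 marks the terms without a logarithm, to be absorbed by 1 ≤ log n at the end.
  have e : 4 / (k : ℝ) + (d * (4 * (4 * Real.log n / (s ^ 4 * n))) +
      2 * (d * (4 * (2 * A) ^ 2)) / n) =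
      s ^ 2 * d * (((4 + 32 * A ^ 2) / s ^ 2 * 1 + 16 / s ^ 6 * Real.log n) / n) := by
    rw [hn]; field_simp; ring
  rw [e] at hfin
  refine (le_of_mul_le_mul_left hfin (by positivity)).trans ?_
  rw [← mul_div_assoc]
  gcongr
  rw [add_mul]
  gcongr

/-! ### Lower bound at the spike -/

theorem spike_mem_box {d : ℕ} (hd : 2 ≤ d) {B : ℝ} (hB : 0 ≤ B) : spike d B ∈ box d B := by
  obtain ⟨m, rfl⟩ : ∃ m, d = m + 2 := ⟨d - 2, by omega⟩
  constructor
  · rw [pi_norm_le_iff_of_nonneg hB]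
    intro i
    rw [Real.norm_eq_abs, spike]
    split_ifs
    · rw [abs_of_nonneg hB]
    · rw [abs_neg, abs_of_nonneg (div_nonneg hB (by push_cast; linarith [Nat.cast_nonneg (α := ℝ) m]))]
      refine div_le_self hB ?_
      push_cast
      linarith [Nat.cast_nonneg (α := ℝ) m]
  · rw [Fin.sum_univ_succ]
    simp only [spike, Fin.val_zero, Fin.val_succ, if_true, Nat.succ_ne_zero, if_false,
      Finset.sum_const, Finset.card_univ, Fintype.card_fin, nsmul_eq_mul]
    have : (m : ℝ) + 1 ≠ 0 := by positivity
    push_cast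
    have e : (m : ℝ) + 2 - 1 = m + 1 := by ring
    rw [e]
    field_simp
    ring

/-- The hypothesis `hl` lets the logarithmic losses consume at most half of E|noise|/2 ≥ (s⁴/18)√n,
with s = σ(−2B). -/
theorem le_integral_sub_mle_spike {d k : ℕ} (hd : 3 ≤ d) (hk : 1 ≤ k) {B : ℝ} (hB : 0 < B)
    (hr : radius B (d * k) < B)
    (hl : (16 / Real.sigmoid (-(2 * B)) ^ 4 + 2) * Real.log (d * k) ≤
      Real.sigmoid (-(2 * B)) ^ 4 / 36 * Real.sqrt (d * k)) :
    Real.sigmoid (-(2 * B)) ^ 4 / 36 / Real.sqrt (d * k) ≤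
      B - ∫ ω : Outcome d k, mle B ω ⟨0, by omega⟩ ∂(law k (spike d B)) := by
  set θ := spike d B with hθdef
  have hθ : θ ∈ box d B := spike_mem_box (by omega) hB.le
  have hd' : (3 : ℝ) ≤ d := by exact_mod_cast hd
  have hk' : (1 : ℝ) ≤ k := by exact_mod_cast hk
  have hmle := fun ω : Outcome d k => isBoxMLE_mle hB.le hk ω
  set z : Fin d := ⟨0, by omega⟩ with hz
  have hθz : θ z = B := by simp [hθdef, spike, hz]
  have hθne : ∀ j, j ≠ z → θ j = -(B / ((d : ℝ) - 1)) := by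
    intro j hj
    rw [hθdef, spike, if_neg]
    intro h; exact hj (Fin.ext h)
  set n : ℝ := d * k with hn
  set s := Real.sigmoid (-(2 * B)) with hs
  have hs0 : 0 < s := Real.sigmoid_pos _
  have hn3 : 3 ≤ n := by rw [hn]; nlinarith
  have hn0 : 0 < n := by linarith
  have hlog : 1 ≤ Real.log n := by
    rw [Real.le_log_iff_exp_le (by linarith)]
    exact (Real.exp_one_lt_d9.le.trans (by norm_num)).trans hn3
  set τ := radius B n with hτ
  have hτ2 : τ ^ 2 = 4 * Real.log n / (s ^ 4 * n) := radius_sq (by linarith)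
  set x := B + B / ((d : ℝ) - 1) with hx
  set w := Real.sigmoid x * (1 - Real.sigmoid x) with hw
  have hw0 : 0 < w := mul_pos (Real.sigmoid_pos x) (by linarith [Real.sigmoid_lt_one x])
  have hle : ∀ ω : Outcome d k, mle B ω z ≤ B := fun ω =>
    (le_abs_self _).trans ((norm_le_pi_norm _ z).trans (hmle ω).1.1)
  have hneg : ∀ ω : Outcome d k, n * w * (mle B ω z - B) ≤ 0 := fun ω =>
    mul_nonpos_of_nonneg_of_nonpos (by positivity) (by linarith [hle ω])
  -- All other coordinates of the spike coincide, so the Laplacian row of the first item has one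
  -- weight w, and the zero sum of the errors leaves only its own error.
  have hlin : ∀ ω : Outcome d k, ∑ j, Real.sigmoid (θ z - θ j) *
      (1 - Real.sigmoid (θ z - θ j)) * ((mle B ω z - θ z) - (mle B ω j - θ j)) =
      d * w * (mle B ω z - B) := by
    intro ω
    have h1 : ∀ j, Real.sigmoid (θ z - θ j) * (1 - Real.sigmoid (θ z - θ j)) *
        ((mle B ω z - θ z) - (mle B ω j - θ j)) =
        w * ((mle B ω z - θ z) - (mle B ω j - θ j)) := by
      intro j
      rcases eq_or_ne j z with rfl | hj
      · simp
      · rw [hw, hx]; congr 2 <;> rw [hθz, hθne j hj, sub_neg_eq_add]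
    simp only [h1]
    have h2 : ∑ j, (mle B ω j - θ j) = 0 := by
      rw [Finset.sum_sub_distrib, (hmle ω).1.2, hθ.2, sub_zero]
    rw [← Finset.mul_sum, Finset.sum_sub_distrib, h2, hθz]
    simp
    ring
  have htyp : ∀ ω ∈ typical k θ, n * w * (mle B ω z - B) ≤
      -((|noise θ ω z| - noise θ ω z) / 2) + n * (4 * τ ^ 2) := by
    intro ω hω
    have herr := fun l => abs_mle_sub_le_radius (by omega) hk hB.le hθ hω l
    -- Since τ < B, the first coordinate is off the lower bound and the others are off the upper
    -- one. Its gradient is therefore the smallest, and the gradients sum to zero.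
    have hg0 : grad ω (mle B ω) z ≤ 0 := by
      have hg : ∀ j, grad ω (mle B ω) z ≤ grad ω (mle B ω) j := by
        intro j
        rcases eq_or_ne j z with rfl | hj
        · exact le_rfl
        refine grad_le_grad (hmle ω) ?_ ?_
        · have := (abs_le.mp (herr z)).1
          rw [hθz] at this; linarith
        · have := (abs_le.mp (herr j)).2
          rw [hθne j hj] at this
          have h0 : 0 ≤ B / ((d : ℝ) - 1) := div_nonneg hB.le (by linarith)
          linarith
      have := Finset.sum_le_sum fun j (_ : j ∈ Finset.univ) => hg j
      rw [sum_grad] at this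
      simp only [Finset.sum_const, Finset.card_univ, Fintype.card_fin, nsmul_eq_mul] at this
      by_contra! hpos
      have : 0 < (d : ℝ) * grad ω (mle B ω) z := mul_pos (by linarith) hpos
      linarith
    rw [grad_eq θ] at hg0
    have h1 := (abs_le.mp (abs_drift_sub_linear_le θ (mle B ω) herr z)).1
    rw [hlin] at h1
    have h2 : n * w * (mle B ω z - B) ≤ noise θ ω z + n * (4 * τ ^ 2) := by
      have := mul_le_mul_of_nonneg_left h1 (Nat.cast_nonneg (α := ℝ) k)
      rw [hn]
      linarith
    have h3 := hneg ω
    have h4 : 0 ≤ n * (4 * τ ^ 2) := by positivity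
    -- (|x| − x)/2 is the negative part of x: `h2` serves when the noise is negative, `h3` when it
    -- is nonnegative.
    rcases abs_cases (noise θ ω z) with ⟨e, _⟩ | ⟨e, _⟩ <;> rw [e] <;> linarith
  -- On every outcome the left side is at most 0 and the negative part of the noise is at most n.
  have hall : ∀ ω : Outcome d k, n * w * (mle B ω z - B) ≤
      -((|noise θ ω z| - noise θ ω z) / 2) + n * (4 * τ ^ 2) + n := by
    intro ω
    have h3 := hneg ω
    have h4 : 0 ≤ n * (4 * τ ^ 2) := by positivity
    have h5 := abs_noise_le θ ω z
    rcases abs_cases (noise θ ω z) with ⟨e, _⟩ | ⟨e, _⟩ <;> rw [e] at h5 ⊢ <;> linarith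
  have hint := integral_le_of_typical (by omega) hk (θ := θ) hn0.le htyp hall
  rw [integral_const_mul, integral_sub (integrable_law θ _) (integrable_law θ _),
    integral_add (integrable_law θ _) (integrable_law θ _), integral_neg, integral_div,
    integral_sub (integrable_law θ _) (integrable_law θ _), integral_noise] at hint
  simp only [integral_const, probReal_univ, one_smul, sub_zero] at hint
  have habs := le_integral_abs_noise (by omega) hk hθ z
  rw [← hn, ← hs] at habs
  have e2 : 2 * n / ((d : ℝ) * k) = 2 := by rw [← hn]; field_simp
  have e3 : n * (4 * τ ^ 2) = 16 / s ^ 4 * Real.log n := by rw [hτ2]; field_simp; norm_num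
  rw [e2, e3] at hint
  set I := ∫ ω : Outcome d k, mle B ω z ∂(law k θ) with hI
  have hsq : Real.sqrt n ^ 2 = n := Real.sq_sqrt hn0.le
  have hsq0 : 0 < Real.sqrt n := Real.sqrt_pos.mpr hn0
  have h1 : s ^ 4 / 36 * Real.sqrt n ≤ n * w * (B - I) := by
    have e : n * w * (I - B) = -(n * w * (B - I)) := by ring
    rw [e] at hint
    have : (16 / s ^ 4 + 2) * Real.log n = 16 / s ^ 4 * Real.log n + 2 * Real.log n := by ring
    linarith
  have hBI : 0 ≤ B - I := by
    have h0 : 0 < n * w * (B - I) := lt_of_lt_of_le (by positivity) h1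
    exact (pos_of_mul_pos_right h0 (by positivity)).le
  have h2 : n * w * (B - I) ≤ n * (B - I) := by
    have := mul_le_mul_of_nonneg_right (sigmoid_deriv_le_one x) (mul_nonneg hn0.le hBI)
    rw [← hw] at this
    linarith
  rw [div_le_iff₀ hsq0]
  refine le_of_mul_le_mul_right ?_ hsq0
  calc s ^ 4 / 36 * Real.sqrt n ≤ n * (B - I) := h1.trans h2
    _ = (B - I) * Real.sqrt n * Real.sqrt n := by nth_rewrite 1 [← hsq]; ring

/-! ### Thresholds for large dk, and conclusion -/

theorem exists_log_le_mul_sqrt {ε : ℝ} (hε : 0 < ε) :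
    ∃ N : ℕ, ∀ x : ℝ, N ≤ x → Real.log x ≤ ε * Real.sqrt x := by
  have h := (isLittleO_log_rpow_atTop (r := 1 / 2) (by norm_num)).bound hε
  obtain ⟨a, ha⟩ := Filter.eventually_atTop.mp h
  refine ⟨⌈a⌉₊, fun x hx => ?_⟩
  have h1 := ha x ((Nat.le_ceil a).trans hx)
  rw [← Real.sqrt_eq_rpow, Real.norm_eq_abs, Real.norm_eq_abs,
    abs_of_nonneg (Real.sqrt_nonneg x)] at h1
  exact (le_abs_self _).trans h1

theorem exists_radius_lt (A : ℝ) {δ : ℝ} (hδ : 0 < δ) :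
    ∃ N : ℕ, ∀ x : ℝ, 1 ≤ x → N ≤ x → radius A x < δ := by
  have hs0 := Real.sigmoid_pos (-(2 * A))
  set s := Real.sigmoid (-(2 * A)) with hs
  obtain ⟨N, hN⟩ := exists_log_le_mul_sqrt (ε := δ ^ 2 * s ^ 4 / 8) (by positivity)
  refine ⟨N, fun x hx hx' => ?_⟩
  have hx0 : 0 < x := by linarith
  have h1 := hN x hx'
  have h2 : Real.sqrt x ≤ x := by
    rw [Real.sqrt_le_left hx0.le]; nlinarith
  refine lt_of_pow_lt_pow_left₀ 2 hδ.le ?_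
  rw [radius_sq hx, ← hs, div_lt_iff₀ (by positivity)]
  have h3 := mul_le_mul_of_nonneg_left h2 (by positivity : 0 ≤ δ ^ 2 * s ^ 4 / 8)
  have h4 : 0 < δ ^ 2 * s ^ 4 * x := by positivity
  linarith

theorem integral_mle_apply {d k : ℕ} (A : ℝ) (θ : Fin d → ℝ) (i : Fin d) :
    ((∫ ω : Outcome d k, mle A ω ∂(law k θ)) - θ) i =
      (∫ ω : Outcome d k, mle A ω i ∂(law k θ)) - θ i := by
  rw [Pi.sub_apply, eval_integral fun j => integrable_law θ _]

end BTL

theorem theorem1 (B : ℝ) (hB : 0 < B) :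
    (∃ c : ℝ, 0 < c ∧ ∃ d₀ k₀ : ℕ, ∀ d k : ℕ, d₀ ≤ d → k₀ ≤ k →
      ENNReal.ofReal (c / Real.sqrt ((d : ℝ) * k)) ≤
        BTL.bias B (BTL.mle B : BTL.Outcome d k → Fin d → ℝ) ∧
      BTL.spike d B ∈ BTL.box d B ∧
      ENNReal.ofReal (c / Real.sqrt ((d : ℝ) * k)) ≤
        BTL.biasAt (BTL.mle B : BTL.Outcome d k → Fin d → ℝ) (BTL.spike d B)) ∧
    (∀ A : ℝ, B < A → ∃ c : ℝ, 0 < c ∧ ∃ d₀ k₀ : ℕ, ∀ d k : ℕ, d₀ ≤ d → k₀ ≤ k →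
      BTL.bias B (BTL.mle A : BTL.Outcome d k → Fin d → ℝ) ≤
        ENNReal.ofReal (c * ((Real.log d + Real.log k) / ((d : ℝ) * k)))) := by
  -- All thresholds concern the product dk ≥ d, so it suffices to bound d below, and k₀ = 1 works.
  have hlarge : ∀ {d k N : ℕ}, max N 3 ≤ d → 1 ≤ k →
      3 ≤ d ∧ (1 : ℝ) ≤ (d : ℝ) * k ∧ (N : ℝ) ≤ (d : ℝ) * k := by
    intro d k N hd hk
    have hdk : d ≤ d * k := Nat.le_mul_of_pos_right d hk
    have h3 : 3 ≤ d := (le_max_right _ _).trans hd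
    have hN : N ≤ d := (le_max_left _ _).trans hd
    refine ⟨h3, ?_, ?_⟩
    · exact_mod_cast (by omega : 1 ≤ d * k)
    · exact_mod_cast hN.trans hdk
  constructor
  · set s := Real.sigmoid (-(2 * B)) with hs
    have hs0 : 0 < s := Real.sigmoid_pos _
    obtain ⟨N₁, hN₁⟩ := BTL.exists_radius_lt B hB
    obtain ⟨N₂, hN₂⟩ := BTL.exists_log_le_mul_sqrt (ε := s ^ 4 / 36 / (16 / s ^ 4 + 2))
      (by positivity)
    refine ⟨s ^ 4 / 36, by positivity, max (max N₁ N₂) 3, 1, fun d k hd hk => ?_⟩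
    obtain ⟨h3, h1, hN⟩ := hlarge hd hk
    have hmem := BTL.spike_mem_box (d := d) (by omega) hB.le
    rw [Nat.cast_max, max_le_iff] at hN
    have hl := hN₂ _ hN.2
    have hmain := BTL.le_integral_sub_mle_spike h3 hk hB (hN₁ _ h1 hN.1) (by
      rw [← hs]
      have := mul_le_mul_of_nonneg_left hl (by positivity : 0 ≤ 16 / s ^ 4 + 2)
      refine this.trans (le_of_eq ?_)
      field_simp)
    have hbias : ENNReal.ofReal (s ^ 4 / 36 / Real.sqrt ((d : ℝ) * k)) ≤
        BTL.biasAt (BTL.mle B : BTL.Outcome d k → Fin d → ℝ) (BTL.spike d B) := by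
      rw [BTL.biasAt, ← ofReal_norm]
      refine ENNReal.ofReal_le_ofReal ((hmain.trans ?_).trans
        (norm_le_pi_norm _ (⟨0, by omega⟩ : Fin d)))
      rw [BTL.integral_mle_apply, Real.norm_eq_abs, abs_sub_comm]
      refine le_trans (le_of_eq ?_) (le_abs_self _)
      simp [BTL.spike]
    exact ⟨hbias.trans (le_iSup₂ (f := fun θ (_ : θ ∈ BTL.box d B) =>
      BTL.biasAt (BTL.mle B : BTL.Outcome d k → Fin d → ℝ) θ) _ hmem), hmem, hbias⟩
  · intro A hA
    have hs0 : 0 < Real.sigmoid (-(2 * A)) := Real.sigmoid_pos _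
    obtain ⟨N, hN'⟩ := BTL.exists_radius_lt A (sub_pos.mpr hA)
    refine ⟨(4 + 32 * A ^ 2) / Real.sigmoid (-(2 * A)) ^ 2 + 16 / Real.sigmoid (-(2 * A)) ^ 6,
      by positivity, max N 3, 1, fun d k hd hk => ?_⟩
    obtain ⟨h3, h1, hN⟩ := hlarge hd hk
    have hlog : Real.log d + Real.log k = Real.log ((d : ℝ) * k) :=
      (Real.log_mul (by positivity) (by positivity)).symm
    rw [hlog]
    refine iSup₂_le fun θ hθ => ?_
    rw [BTL.biasAt, ← ofReal_norm]
    refine ENNReal.ofReal_le_ofReal ((pi_norm_le_iff_of_nonneg ?_).mpr fun i => ?_)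
    · have := Real.log_nonneg h1
      positivity
    · rw [BTL.integral_mle_apply]
      exact BTL.abs_integral_mle_sub_le h3 hk hB hA (hN' _ h1 hN) hθ i
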